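/- Let \(\Sigma\) be a finite alphabet. A tagging \(t\) of \(\Sigma\) declares every symbol to be a call symbol, a return symbol or a plain symbol, and comes with a set of call-return pairs \((a,b)\), where \(a\) is a call symbol and \(b\) is a return symbol (in particular, this may be a set of pairs in which each call symbol has a unique return symbol, or the set of all such pairs). For a word \(s\), let \(t(s)\) be the word in which every symbol carries its tag, and let \(\hat\Sigma_t\) be the set of tagged symbols \(t(i)\), \(i\in\Sigma\). A language over \(\hat\Sigma_t\) is a visibly pushdown language (VPL) if it is generated by a grammar with finitely many rules, each of the form \(A\to\varepsilon\), \(A\to cB\) or \(A\to \langle a\,B\,b\rangle\,C\), where \(A,B,C\) are nonterminals, \(c\) is a plain symbol, \(\langle a\) a call symbol and \(b\rangle\) a return symbol of \(\hat\Sigma_t\). A word is well-matched under \(t\) if its call and return symbols are properly nested, each call symbol being matched with a return symbol with which it forms a pair of \(t\). Let \(L\subseteq\Sigma^*\). A nesting pattern of a word \(s\in L\) is a partition \(s=uxzyv\) with \(x,y\) non-empty such that \(ux^kzy^kv\in L\) for all \(k\ge 1\), and \(ux^kzy^jv\notin L\) for all \(k\neq j\), \(k,j\ge 0\). The tagging \(t\)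 is compatible with \(L\) if every word of \(L\) is well-matched under \(t\) and, for every nesting pattern \(s=uxzyv\) of every word \(s\in L\), there is a pair \((a,b)\) of \(t\) such that \(x\) contains an occurrence of the call symbol \(a\) whose matching symbol in \(t(s)\) does not lie in \(x\), and \(y\) contains an occurrence of the return symbol \(b\) whose matching symbol in \(t(s)\) does not lie in \(y\). Theorem. Let \(L\subseteq\Sigma^*\) and let \(t_{\mathcal O}\) be a tagging such that \(\{t_{\mathcal O}(s)\mid s\in L\}\) is a VPL over \(\hat\Sigma_{t_{\mathcal O}}\). Then for every tagging \(t\) compatible with \(L\), the language \(\{t(s)\mid s\in L\}\) is a VPL over \(\hat\Sigma_t\). -/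

import Mathlib

/-- The three kinds of symbols of a visibly pushdown alphabet. -/
inductive SymbolKind where
  | plain
  | call
  | ret

/-- A tagged symbol: a symbol of the untagged alphabet together with its tag, so that
`(.call, a)`, `(.ret, a)` and `(.plain, a)` are the call symbol `‹a`, the return symbol `a›`
and the plain symbol `a`. -/
abbrev TaggedSymbol (α : Type*) : Type _ := SymbolKind × α

/-- A tagging of the alphabet `α`: every symbol is declared call, return or plain (`kind`), and
`pair a b` says that the call symbol `a` and the return symbol `b` form a call-return pair of the
tagging. A tagging given as a set of pairs in which every call symbol has exactly one return
symbol is an instance; so is a bare tagging function, whose pairs are all pairs consisting of a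
call symbol and a return symbol. -/
structure Tagging (α : Type*) where
  /-- call, return or plain -/
  kind : α → SymbolKind
  /-- the call-return pairs -/
  pair : α → α → Prop
  /-- the first component of a pair is a call symbol -/
  kind_left : ∀ a b, pair a b → kind a = SymbolKind.call
  /-- the second component of a pair is a return symbol -/
  kind_right : ∀ a b, pair a b → kind b = SymbolKind.ret

/-- A grammar over tagged symbols is a (well-matched) visibly pushdown grammar if every rule has
one of the forms `A → ε`, `A → c B` with `c` plain, or `A → ‹a B b› C` with `‹a` a call symbol and
`b›` a return symbol. -/
def ContextFreeGrammar.IsVPG {α : Type*} (G : ContextFreeGrammar (TaggedSymbol α)) : Prop :=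
  ∀ r ∈ G.rules,
    r.output = [] ∨
    (∃ (c : α) (B : G.NT),
      r.output = [Symbol.terminal (SymbolKind.plain, c), Symbol.nonterminal B]) ∨
    (∃ (a b : α) (B C : G.NT),
      r.output = [Symbol.terminal (SymbolKind.call, a), Symbol.nonterminal B,
        Symbol.terminal (SymbolKind.ret, b), Symbol.nonterminal C])

/-- `G.TerminalsIn S`: all terminals in the rules of `G` belong to `S`. -/
def ContextFreeGrammar.TerminalsIn {T : Type*} (G : ContextFreeGrammar T) (S : Set T) : Prop :=
  ∀ r ∈ G.rules, ∀ x : T, Symbol.terminal x ∈ r.output → x ∈ S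

/-- `M` is a visibly pushdown language over the terminal set `S`: it is generated by a visibly
pushdown grammar with terminals in `S`. -/
def IsVPL {α : Type*} (S : Set (TaggedSymbol α)) (M : Language (TaggedSymbol α)) : Prop :=
  ∃ G : ContextFreeGrammar (TaggedSymbol α), G.IsVPG ∧ G.TerminalsIn S ∧ G.language = M

/-- `wordPow x k` is the word `x` repeated `k` times. -/
def wordPow {α : Type*} (x : List α) (k : ℕ) : List α := (List.replicate k x).flatten

/-- The partition `u x z y v` of the word `u ++ x ++ z ++ y ++ v` of `L` is a nesting pattern. -/
structure IsNestingPattern {α : Type*} (L : Language α) (u x z y v : List α) : Prop where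
  mem : u ++ x ++ z ++ y ++ v ∈ L
  left_ne_nil : x ≠ []
  right_ne_nil : y ≠ []
  pump : ∀ k : ℕ, 1 ≤ k → u ++ wordPow x k ++ z ++ wordPow y k ++ v ∈ L
  unbalanced : ∀ k j : ℕ, k ≠ j → u ++ wordPow x k ++ z ++ wordPow y j ++ v ∉ L

namespace Tagging

variable {α : Type*}

/-- The tagging as a function from symbols to tagged symbols. -/
def symbol (t : Tagging α) (i : α) : TaggedSymbol α := (t.kind i, i)

/-- The tagged alphabet of `t`. -/
def terminals (t : Tagging α) : Set (TaggedSymbol α) := Set.range t.symbol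

/-- The tagged language `{ t(s) | s ∈ L }`, where `t` acts on words symbol by symbol. -/
def taggedLanguage (t : Tagging α) (L : Language α) : Language (TaggedSymbol α) :=
  Language.map t.symbol L

/-- The word `s` is well-matched under `t`: call and return symbols are properly nested and each
call symbol is matched with a return symbol with which it forms a pair of `t`. -/
inductive WellMatched (t : Tagging α) : List α → Prop
  | nil : WellMatched t []
  | plain (c : α) (s : List α) : t.kind c = SymbolKind.plain → WellMatched t s →
      WellMatched t (c :: s)
  | matched (a b : α) (s₁ s₂ : List α) : t.pair a b → WellMatched t s₁ → WellMatched t s₂ →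
      WellMatched t (a :: (s₁ ++ b :: s₂))

/-- Under `t`, some occurrence of the symbol `a` in `x` is a call that is not matched within `x`:
it is followed in `x` by no return symbol that forms a pair with `a` and is separated from it by a
well-matched word. If `x` is a factor of a well-matched word `s`, this says that the return symbol
that is matched with this occurrence in `s` lies outside `x`. -/
def HasUnmatchedCall (t : Tagging α) (a : α) (x : List α) : Prop :=
  t.kind a = SymbolKind.call ∧ ∃ p q : List α, x = p ++ a :: q ∧
    ¬ ∃ (m : List α) (b : α) (r : List α), q = m ++ b :: r ∧ t.WellMatched m ∧ t.pair a b

/-- Under `t`, some occurrence of the symbol `b` in `y` is a return that is not matched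
within `y`. -/
def HasUnmatchedRet (t : Tagging α) (b : α) (y : List α) : Prop :=
  t.kind b = SymbolKind.ret ∧ ∃ p q : List α, y = p ++ b :: q ∧
    ¬ ∃ (r : List α) (a : α) (m : List α), p = r ++ a :: m ∧ t.WellMatched m ∧ t.pair a b

/-- `t` is compatible with a nesting pattern whose repeated parts are `x` and `y`. -/
def CompatibleWithPattern (t : Tagging α) (x y : List α) : Prop :=
  ∃ a b : α, t.pair a b ∧ t.HasUnmatchedCall a x ∧ t.HasUnmatchedRet b y

/-- `t` is compatible with a set `S` of words of the language `L`: the words of `S` are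
well-matched under `t`, and `t` is compatible with all nesting patterns (with respect to `L`) of
words of `S`. -/
def CompatibleWithWords (t : Tagging α) (L : Language α) (S : Set (List α)) : Prop :=
  (∀ s ∈ S, t.WellMatched s) ∧
  ∀ u x z y v : List α, u ++ x ++ z ++ y ++ v ∈ S → IsNestingPattern L u x z y v →
    t.CompatibleWithPattern x y

/-- `t` is compatible with the language `L`: it is compatible with each word of `L`. -/
def Compatible (t : Tagging α) (L : Language α) : Prop :=
  ∀ s ∈ L, t.CompatibleWithWords L {s}

end Tagging

/-! The grammar for `tO` is read as a pushdown automaton whose stack follows the nesting of `tO`.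
The heart of the proof is that on a factor `w` well-matched under `t`, this automaton pops and
pushes boundedly many frames (`exists_bounded_pop_push`), although `w` may be far from well-matched
under `tO`.

If a frame occurs twice on the stack of an accepting run, the part of the run between the two pushes
can be pumped and gives a nesting pattern (`isNestingPattern_of_loop`). Compatibility forces its
left part to have positive height under `t` (`height_pos`): a negative height would be pumped to a
negative prefix, and at height zero a rotation of the pattern would leave no unmatched call. Hence
every loop on the stack has negative `t`-height (`sum_frameHeight_of_loop`). Since all words of `L`
have height zero, heights of factors are differences of a potential on configurations, and
well-matchedness of `w` bounds from below the height of each top segment of the popped or pushed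
stack. A list over a finite set with negative loops and prefix sums bounded below is short
(`List.exists_length_le_of_loops_neg`).

So the effect of `w` on the automaton is one of finitely many, and it determines the contexts of `w`
in `L` (`finite_contexts`). The finitely many context classes of well-matched words then serve as
nonterminals of a visibly pushdown grammar for `t` (`isVPL_of_finite_contexts`). -/

namespace ContextFreeGrammar

/-! ### Derivations of a visibly pushdown grammar as an inductive predicate. -/

variable {α : Type*}

/-- `G.Gen A s`: the visibly pushdown rules of `G` generate from `A` a word whose untagged form
is `s`. -/
inductive Gen (G : ContextFreeGrammar (TaggedSymbol α)) : G.NT → List α → Prop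
  | eps (A : G.NT) : ⟨A, []⟩ ∈ G.rules → Gen G A []
  | plain (A B : G.NT) (c : α) (s : List α) :
      ⟨A, [Symbol.terminal (SymbolKind.plain, c), Symbol.nonterminal B]⟩ ∈ G.rules →
      Gen G B s → Gen G A (c :: s)
  | matched (A B C : G.NT) (a b : α) (s₁ s₂ : List α) :
      ⟨A, [Symbol.terminal (SymbolKind.call, a), Symbol.nonterminal B,
        Symbol.terminal (SymbolKind.ret, b), Symbol.nonterminal C]⟩ ∈ G.rules →
      Gen G B s₁ → Gen G C s₂ → Gen G A (a :: (s₁ ++ b :: s₂))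

/-- The words derived from a sentential form, read off symbol by symbol. -/
def GenForm (G : ContextFreeGrammar (TaggedSymbol α)) (t : Tagging α) :
    List (Symbol (TaggedSymbol α) G.NT) → List α → Prop
  | [], s => s = []
  | Symbol.terminal x :: r, s => ∃ c s', s = c :: s' ∧ x = t.symbol c ∧ GenForm G t r s'
  | Symbol.nonterminal A :: r, s => ∃ s₁ s₂, s = s₁ ++ s₂ ∧ G.Gen A s₁ ∧ GenForm G t r s₂

variable {G : ContextFreeGrammar (TaggedSymbol α)} {t : Tagging α}

theorem genForm_append (p q : List (Symbol (TaggedSymbol α) G.NT)) (s : List α) :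
    G.GenForm t (p ++ q) s ↔ ∃ s₁ s₂, s = s₁ ++ s₂ ∧ G.GenForm t p s₁ ∧ G.GenForm t q s₂ := by
  induction p generalizing s with
  | nil => simp [GenForm]
  | cons x p ih =>
    cases x with
    | terminal x =>
      simp only [List.cons_append, GenForm, ih]
      constructor
      · rintro ⟨c, _, rfl, hx, s₁, s₂, rfl, h₁, h₂⟩
        exact ⟨c :: s₁, s₂, rfl, ⟨c, s₁, rfl, hx, h₁⟩, h₂⟩
      · rintro ⟨_, s₂, rfl, ⟨c, s₁, rfl, hx, h₁⟩, h₂⟩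
        exact ⟨c, _, rfl, hx, s₁, s₂, rfl, h₁, h₂⟩
    | nonterminal A =>
      simp only [List.cons_append, GenForm, ih]
      constructor
      · rintro ⟨s₀, _, rfl, hA, s₁, s₂, rfl, h₁, h₂⟩
        exact ⟨s₀ ++ s₁, s₂, by simp, ⟨s₀, s₁, rfl, hA, h₁⟩, h₂⟩
      · rintro ⟨_, s₂, rfl, ⟨s₀, s₁, rfl, hA, h₁⟩, h₂⟩
        exact ⟨s₀, s₁ ++ s₂, by simp, hA, s₁, s₂, rfl, h₁, h₂⟩

theorem genForm_map_terminal (s : List α) :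
    G.GenForm t ((s.map t.symbol).map Symbol.terminal) s := by
  induction s with
  | nil => rfl
  | cons c s ih => exact ⟨c, s, rfl, rfl, ih⟩

theorem Gen.of_rule (hG : G.IsVPG) {r : ContextFreeRule (TaggedSymbol α) G.NT}
    (hr : r ∈ G.rules) {s : List α} (hs : G.GenForm t r.output s) : G.Gen r.input s := by
  obtain ⟨A, o⟩ := r
  rcases hG _ hr with h | ⟨c, B, h⟩ | ⟨a, b, B, C, h⟩ <;> simp only at h hs ⊢ <;> subst h
  · obtain rfl : s = [] := hs
    exact .eps A hr
  · obtain ⟨c', _, rfl, hc, s₁, _, rfl, h₁, rfl⟩ := hs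
    obtain rfl : c = c' := congrArg Prod.snd hc
    rw [List.append_nil]
    exact .plain A B c s₁ hr h₁
  · obtain ⟨a', _, rfl, ha, s₁, _, rfl, h₁, b', _, rfl, hb, s₂, _, rfl, h₂, rfl⟩ := hs
    obtain rfl : a = a' := congrArg Prod.snd ha
    obtain rfl : b = b' := congrArg Prod.snd hb
    rw [List.append_nil]
    exact .matched A B C a b s₁ s₂ hr h₁ h₂

/-- The derivation is traversed backwards from its terminal word; undoing a rewriting step replaces
the factor read from the output of a rule by one `Gen` of its input. -/
theorem genForm_of_derives (hG : G.IsVPG) {p : List (Symbol (TaggedSymbol α) G.NT)} {s : List α}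
    (h : G.Derives p ((s.map t.symbol).map Symbol.terminal)) : G.GenForm t p s := by
  induction h using Relation.ReflTransGen.head_induction_on with
  | refl => exact genForm_map_terminal s
  | head h _ ih =>
    obtain ⟨r, hr, hrw⟩ := h
    obtain ⟨p, q, rfl, rfl⟩ := hrw.exists_parts
    simp only [genForm_append] at ih ⊢
    obtain ⟨_, s₃, rfl, ⟨s₁, s₂, rfl, h₁, h₂⟩, h₃⟩ := ih
    exact ⟨_, s₃, rfl, ⟨s₁, s₂, rfl, h₁, s₂, [], by simp, .of_rule hG hr h₂, rfl⟩, h₃⟩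

theorem symbol_of_rule (hT : G.TerminalsIn t.terminals)
    {r : ContextFreeRule (TaggedSymbol α) G.NT} (hr : r ∈ G.rules) {k : SymbolKind} {c : α}
    (hc : Symbol.terminal (k, c) ∈ r.output) : t.symbol c = (k, c) := by
  obtain ⟨d, hd⟩ := hT r hr _ hc
  obtain rfl : d = c := congrArg Prod.snd hd
  exact hd

theorem Gen.derives (hT : G.TerminalsIn t.terminals) {A : G.NT} {s : List α} (h : G.Gen A s) :
    G.Derives [Symbol.nonterminal A] ((s.map t.symbol).map Symbol.terminal) := by
  induction h with
  | eps A hr => exact Produces.single ⟨_, hr, ContextFreeRule.Rewrites.input_output⟩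
  | plain A B c s hr _ ih =>
    refine Produces.trans_derives ⟨_, hr, ContextFreeRule.Rewrites.input_output⟩ ?_
    have := ih.append_left [Symbol.terminal (t.symbol c)]
    rw [symbol_of_rule (k := .plain) hT hr (by simp)] at this
    simpa [symbol_of_rule (k := .plain) (c := c) hT hr (by simp)] using this
  | matched A B C a b s₁ s₂ hr _ _ ih₁ ih₂ =>
    refine Produces.trans_derives ⟨_, hr, ContextFreeRule.Rewrites.input_output⟩ ?_
    have ha : t.symbol a = (.call, a) := symbol_of_rule hT hr (by simp)
    have hb : t.symbol b = (.ret, b) := symbol_of_rule hT hr (by simp)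
    have h₁ := (ih₁.append_left [Symbol.terminal (t.symbol a)]).append_right
      [Symbol.terminal (t.symbol b), Symbol.nonterminal C]
    have h₂ := ih₂.append_left
      (Symbol.terminal (t.symbol a) :: ((s₁.map t.symbol).map Symbol.terminal) ++
        [Symbol.terminal (t.symbol b)])
    have := Derives.trans (by simpa using h₁) (by simpa using h₂)
    simpa [ha, hb] using this

theorem map_symbol_mem_language_iff (hG : G.IsVPG) (hT : G.TerminalsIn t.terminals)
    {s : List α} : s.map t.symbol ∈ G.language ↔ G.Gen G.initial s := by
  constructor
  · intro h
    obtain ⟨s₁, _, rfl, h₁, rfl⟩ := genForm_of_derives hG h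
    simpa using h₁
  · exact fun h ↦ h.derives hT

theorem exists_map_symbol_of_mem_language (hT : G.TerminalsIn t.terminals)
    {W : List (TaggedSymbol α)} (hW : W ∈ G.language) : ∃ s : List α, s.map t.symbol = W := by
  have h (p : List (Symbol (TaggedSymbol α) G.NT)) (hp : G.Derives [.nonterminal G.initial] p) :
      ∀ x, Symbol.terminal x ∈ p → x ∈ t.terminals := by
    induction hp with
    | refl => simp
    | tail _ h ih =>
      obtain ⟨r, hr, hrw⟩ := h
      obtain ⟨p, q, rfl, rfl⟩ := hrw.exists_parts
      intro x hx
      rcases List.mem_append.1 hx with hx | hx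
      · rcases List.mem_append.1 hx with hx | hx
        · exact ih x (by simp [hx])
        · exact hT r hr x hx
      · exact ih x (by simp [hx])
  have hW' : W ∈ Set.range (List.map t.symbol) := by
    rw [Set.range_list_map]
    exact fun x hx ↦ h _ hW x (List.mem_map_of_mem hx)
  exact hW'

/-! ### The leftmost pushdown automaton. -/

/-- A pushed rule `A → ‹a B b› C`. -/
structure Frame (G : ContextFreeGrammar (TaggedSymbol α)) where
  /-- the left-hand side of the rule -/
  lhs : G.NT
  /-- the nonterminal between call and return -/
  inner : G.NT
  /-- the nonterminal after the return -/
  next : G.NT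
  /-- the call symbol -/
  call : α
  /-- the return symbol -/
  ret : α
  mem : ⟨lhs, [Symbol.terminal (SymbolKind.call, call), Symbol.nonterminal inner,
    Symbol.terminal (SymbolKind.ret, ret), Symbol.nonterminal next]⟩ ∈ G.rules

instance : Finite G.Frame := by
  refine Finite.of_injective (β := G.rules) (fun f ↦ ⟨_, f.mem⟩) ?_
  rintro ⟨A, B, C, a, b, h⟩ ⟨A', B', C', a', b', h'⟩ hf
  simpa [and_assoc, and_comm, and_left_comm] using hf

/-- A step of the leftmost pushdown automaton of `G`; a configuration consists of the leftmost
nonterminal and the stack of rules that wait for their return symbol. -/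
def Step (G : ContextFreeGrammar (TaggedSymbol α)) (p : G.NT × List G.Frame) (c : α)
    (q : G.NT × List G.Frame) : Prop :=
  (∃ B, ⟨p.1, [Symbol.terminal (SymbolKind.plain, c), Symbol.nonterminal B]⟩ ∈ G.rules ∧
    q = (B, p.2)) ∨
  (∃ f : G.Frame, p.1 = f.lhs ∧ c = f.call ∧ q = (f.inner, f :: p.2)) ∨
  (∃ (f : G.Frame) (γ : List G.Frame), ⟨p.1, []⟩ ∈ G.rules ∧ p.2 = f :: γ ∧ c = f.ret ∧
    q = (f.next, γ))

/-- Runs of the leftmost pushdown automaton of `G`. -/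
def Run (G : ContextFreeGrammar (TaggedSymbol α)) :
    G.NT × List G.Frame → List α → G.NT × List G.Frame → Prop
  | p, [], q => p = q
  | p, c :: u, q => ∃ r, G.Step p c r ∧ G.Run r u q

/-- `y` completes the rules on the stack. -/
def Tail (G : ContextFreeGrammar (TaggedSymbol α)) : List G.Frame → List α → Prop
  | [], y => y = []
  | f :: γ, y => ∃ z y', y = f.ret :: (z ++ y') ∧ G.Gen f.next z ∧ G.Tail γ y'

/-- `v` is accepted from the configuration `p`. -/
def Acc (G : ContextFreeGrammar (TaggedSymbol α)) (p : G.NT × List G.Frame) (v : List α) : Prop :=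
  ∃ z y, v = z ++ y ∧ G.Gen p.1 z ∧ G.Tail p.2 y

theorem acc_nil_iff {A : G.NT} {s : List α} : G.Acc (A, []) s ↔ G.Gen A s := by
  simp [Acc, Tail]

theorem tail_append_iff {γ δ : List G.Frame} {y : List α} :
    G.Tail (γ ++ δ) y ↔ ∃ y₁ y₂, y = y₁ ++ y₂ ∧ G.Tail γ y₁ ∧ G.Tail δ y₂ := by
  induction γ generalizing y with
  | nil => simp [Tail]
  | cons f γ ih =>
    simp only [List.cons_append, Tail, ih]
    constructor
    · rintro ⟨z, _, rfl, hz, y₁, y₂, rfl, h₁, h₂⟩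
      exact ⟨f.ret :: (z ++ y₁), y₂, by simp, ⟨z, y₁, rfl, hz, h₁⟩, h₂⟩
    · rintro ⟨_, y₂, rfl, ⟨z, y₁, rfl, hz, h₁⟩, h₂⟩
      exact ⟨z, y₁ ++ y₂, by simp, hz, y₁, y₂, rfl, h₁, h₂⟩

theorem Acc.cons_of_step {p q : G.NT × List G.Frame} {c : α} {v : List α} (h : G.Step p c q)
    (hv : G.Acc q v) : G.Acc p (c :: v) := by
  obtain ⟨A, γ⟩ := p
  obtain ⟨z, y, rfl, hz, hy⟩ := hv
  rcases h with ⟨B, hr, rfl⟩ | ⟨f, rfl, rfl, rfl⟩ | ⟨f, γ', hr, h, rfl, rfl⟩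
  · exact ⟨c :: z, y, rfl, .plain _ _ _ _ hr hz, hy⟩
  · obtain ⟨z', y', rfl, hz', hy'⟩ := hy
    exact ⟨f.call :: (z ++ f.ret :: z'), y', by simp, .matched _ _ _ _ _ _ _ f.mem hz hz', hy'⟩
  · obtain rfl : γ = f :: γ' := h
    exact ⟨[], _, rfl, .eps _ hr, z, y, rfl, hz, hy⟩

theorem Acc.exists_step {p : G.NT × List G.Frame} {c : α} {v : List α} (h : G.Acc p (c :: v)) :
    ∃ q, G.Step p c q ∧ G.Acc q v := by
  obtain ⟨A, γ⟩ := p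
  obtain ⟨z, y, hv, hz, hy⟩ := h
  simp only at hz hy
  cases hz with
  | eps _ hr =>
    obtain rfl : c :: v = y := hv
    cases γ with
    | nil => cases hy
    | cons f γ =>
      obtain ⟨z, y', he, hz, hy⟩ := hy
      obtain ⟨rfl, rfl⟩ := List.cons.inj he
      exact ⟨(f.next, γ), .inr (.inr ⟨f, γ, hr, rfl, rfl, rfl⟩), z, y', rfl, hz, hy⟩
  | plain _ B c' s hr hs =>
    obtain ⟨rfl, rfl⟩ := List.cons.inj hv
    exact ⟨(B, γ), .inl ⟨B, hr, rfl⟩, s, y, rfl, hs, hy⟩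
  | matched _ B C a b s₁ s₂ hr h₁ h₂ =>
    obtain ⟨rfl, rfl⟩ := List.cons.inj hv
    exact ⟨(B, ⟨A, B, C, c, b, hr⟩ :: γ), .inr (.inl ⟨⟨A, B, C, c, b, hr⟩, rfl, rfl, rfl⟩), s₁,
      b :: (s₂ ++ y), by simp, h₁, s₂, y, rfl, h₂, hy⟩

/-- This is the correctness of the automaton, and the only bridge needed between derivations and
runs: with `acc_nil_iff` it cuts a derivation at an arbitrary position of the word. -/
theorem acc_append_iff {p : G.NT × List G.Frame} {u v : List α} :
    G.Acc p (u ++ v) ↔ ∃ q, G.Run p u q ∧ G.Acc q v := by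
  induction u generalizing p with
  | nil => simp [Run]
  | cons c u ih =>
    constructor
    · intro h
      obtain ⟨r, hr, hv⟩ := h.exists_step
      obtain ⟨q, hq, hv⟩ := ih.1 hv
      exact ⟨q, ⟨r, hr, hq⟩, hv⟩
    · rintro ⟨q, ⟨r, hr, hq⟩, hv⟩
      exact (ih.2 ⟨q, hq, hv⟩).cons_of_step hr

theorem run_append_iff {p q : G.NT × List G.Frame} {u v : List α} :
    G.Run p (u ++ v) q ↔ ∃ r, G.Run p u r ∧ G.Run r v q := by
  induction u generalizing p with
  | nil => simp [Run]
  | cons c u ih =>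
    simp only [List.cons_append, Run, ih]
    constructor
    · rintro ⟨r, hr, r', h₁, h₂⟩
      exact ⟨r', ⟨r, hr, h₁⟩, h₂⟩
    · rintro ⟨r', ⟨r, hr, h₁⟩, h₂⟩
      exact ⟨r, hr, r', h₁, h₂⟩

theorem run_singleton_iff {p q : G.NT × List G.Frame} {c : α} :
    G.Run p [c] q ↔ G.Step p c q := by
  simp [Run]

theorem Step.append_stack {A A' : G.NT} {γ γ' : List G.Frame} {c : α}
    (h : G.Step (A, γ) c (A', γ')) (δ : List G.Frame) : G.Step (A, γ ++ δ) c (A', γ' ++ δ) := by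
  rcases h with ⟨B, hr, h⟩ | ⟨f, hf, rfl, h⟩ | ⟨f, γ'', hr, hf, rfl, h⟩
  · cases h
    exact .inl ⟨_, hr, rfl⟩
  · cases h
    exact .inr (.inl ⟨f, hf, rfl, rfl⟩)
  · cases h
    exact .inr (.inr ⟨f, _, hr, by simp only at hf; simp [hf], rfl, rfl⟩)

theorem Run.append_stack {A A' : G.NT} {γ γ' : List G.Frame} {u : List α}
    (h : G.Run (A, γ) u (A', γ')) (δ : List G.Frame) : G.Run (A, γ ++ δ) u (A', γ' ++ δ) := by
  induction u generalizing A γ with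
  | nil => cases h; rfl
  | cons c u ih =>
    obtain ⟨⟨B, ε⟩, h₁, h₂⟩ := h
    exact ⟨_, h₁.append_stack δ, ih h₂⟩

/-- A run first pops the top of the stack and then pushes onto the rest. -/
theorem Run.exists_pop_push {p q : G.NT × List G.Frame} {w : List α} (h : G.Run p w q) :
    ∃ (pop push δ : List G.Frame) (Z : G.NT) (w₁ w₂ : List α), p.2 = pop ++ δ ∧
      q.2 = push ++ δ ∧ w = w₁ ++ w₂ ∧ G.Run (p.1, pop) w₁ (Z, []) ∧
      G.Run (Z, []) w₂ (q.1, push) := by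
  induction w generalizing p with
  | nil =>
    cases h
    exact ⟨[], [], q.2, q.1, [], [], rfl, rfl, rfl, rfl, rfl⟩
  | cons c w ih =>
    obtain ⟨A, γ⟩ := p
    obtain ⟨r, hs, hr⟩ := h
    obtain ⟨pop, push, δ, Z, w₁, w₂, hp, hq, rfl, h₁, h₂⟩ := ih hr
    rcases hs with ⟨B, hB, rfl⟩ | ⟨f, rfl, rfl, rfl⟩ | ⟨f, γ', hA, hγ, rfl, rfl⟩
    · exact ⟨pop, push, δ, Z, c :: w₁, w₂, hp, hq, rfl, ⟨_, .inl ⟨B, hB, rfl⟩, h₁⟩, h₂⟩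
    · cases pop with
      | nil =>
        obtain rfl : f :: γ = δ := hp
        -- The frame `f` just pushed is never popped, so the stack is lowest at the very start:
        -- nothing is popped and `f` becomes the bottom of the pushed part.
        refine ⟨[], push ++ [f], γ, f.lhs, [], f.call :: (w₁ ++ w₂), rfl, by simp [hq], rfl, rfl,
          (f.inner, [f]), .inr (.inl ⟨f, rfl, rfl, rfl⟩), ?_⟩
        exact (run_append_iff.2 ⟨_, h₁, h₂⟩).append_stack [f]
      | cons g pop =>
        obtain ⟨rfl, rfl⟩ := List.cons.inj hp
        exact ⟨pop, push, δ, Z, f.call :: w₁, w₂, rfl, hq, rfl,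
          ⟨_, .inr (.inl ⟨f, rfl, rfl, rfl⟩), h₁⟩, h₂⟩
    · simp only at hγ hp
      subst hp hγ
      exact ⟨f :: pop, push, δ, Z, f.ret :: w₁, w₂, rfl, hq, rfl,
        ⟨_, .inr (.inr ⟨f, pop, hA, rfl, rfl, rfl⟩), h₁⟩, h₂⟩

/-- The run is cut at the moment when this occurrence of `f` is popped; until then the frames `δ`
below it are not touched. -/
theorem Run.exists_pop_prefix {A Z : G.NT} {γ δ : List G.Frame} {f : G.Frame} {w : List α}
    (h : G.Run (A, γ ++ f :: δ) w (Z, [])) :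
    ∃ w₁ w₂, w = w₁ ++ w₂ ∧ G.Run (A, γ ++ [f]) w₁ (f.next, []) ∧
      G.Run (f.next, δ) w₂ (Z, []) := by
  induction w generalizing A γ with
  | nil => simp [Run] at h
  | cons c w ih =>
    obtain ⟨r, hs, hr⟩ := h
    rcases hs with ⟨B, hB, rfl⟩ | ⟨g, hg, rfl, rfl⟩ | ⟨g, γ', hA, hγ, rfl, rfl⟩
    · obtain ⟨w₁, w₂, rfl, h, h'⟩ := ih hr
      exact ⟨c :: w₁, w₂, rfl, ⟨_, .inl ⟨B, hB, rfl⟩, h⟩, h'⟩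
    · obtain ⟨w₁, w₂, rfl, h, h'⟩ := ih (γ := g :: γ) hr
      exact ⟨g.call :: w₁, w₂, rfl, ⟨_, .inr (.inl ⟨g, hg, rfl, rfl⟩), h⟩, h'⟩
    · cases γ with
      | nil =>
        obtain ⟨rfl, rfl⟩ := List.cons.inj hγ
        exact ⟨[f.ret], w, rfl, ⟨_, .inr (.inr ⟨f, [], hA, rfl, rfl, rfl⟩), rfl⟩, hr⟩
      | cons g' γ =>
        obtain ⟨rfl, rfl⟩ := List.cons.inj hγ
        obtain ⟨w₁, w₂, rfl, h, h'⟩ := ih hr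
        exact ⟨g'.ret :: w₁, w₂, rfl, ⟨_, .inr (.inr ⟨g', _, hA, rfl, rfl, rfl⟩), h⟩, h'⟩

/-- The run is cut at the push of the occurrence of `f` that survives to the end. Induction is on
the last letter, because later steps change only the stack above `f`. -/
theorem Run.exists_push {A X : G.NT} {γ δ : List G.Frame} {f : G.Frame} {w : List α}
    (h : G.Run (A, []) w (X, γ ++ f :: δ)) :
    ∃ p q, w = p ++ f.call :: q ∧ G.Run (A, []) p (f.lhs, δ) ∧
      G.Run (f.inner, []) q (X, γ) := by
  induction w using List.reverseRecOn generalizing X γ with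
  | nil => simp [Run] at h
  | append_singleton w c ih =>
    obtain ⟨⟨Y, ε⟩, hr, hs⟩ := run_append_iff.1 h
    rcases run_singleton_iff.1 hs with ⟨B, hB, hq⟩ | ⟨g, hg, rfl, hq⟩ | ⟨g, γ', hA, hγ, rfl, hq⟩
    · obtain ⟨rfl, rfl⟩ := Prod.mk.inj hq
      obtain ⟨p, q, rfl, h₁, h₂⟩ := ih hr
      exact ⟨p, q ++ [c], by simp, h₁,
        run_append_iff.2 ⟨_, h₂, run_singleton_iff.2 (.inl ⟨X, hB, rfl⟩)⟩⟩
    · simp only [Prod.mk.injEq] at hq hg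
      obtain ⟨rfl, hq⟩ := hq
      subst hg
      cases γ with
      | nil =>
        obtain ⟨rfl, rfl⟩ := List.cons.inj hq
        exact ⟨w, [], by simp, hr, rfl⟩
      | cons g' γ =>
        obtain ⟨rfl, rfl⟩ := List.cons.inj hq
        obtain ⟨p, q, rfl, h₁, h₂⟩ := ih hr
        exact ⟨p, q ++ [g'.call], by simp, h₁,
          run_append_iff.2 ⟨_, h₂, run_singleton_iff.2 (.inr (.inl ⟨g', rfl, rfl, rfl⟩))⟩⟩
    · simp only [Prod.mk.injEq] at hq hγ
      obtain ⟨rfl, rfl⟩ := hq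
      subst hγ
      obtain ⟨p, q, rfl, h₁, h₂⟩ := ih (γ := g :: γ) hr
      exact ⟨p, q ++ [g.ret], by simp, h₁,
        run_append_iff.2 ⟨_, h₂, run_singleton_iff.2 (.inr (.inr ⟨g, _, hA, rfl, rfl, rfl⟩))⟩⟩

end ContextFreeGrammar


/-! ### Nesting height under a tagging. -/

theorem List.isPrefix_append_cases {α : Type*} {p a b : List α} (h : p <+: a ++ b) :
    p <+: a ∨ ∃ r, p = a ++ r ∧ r <+: b := by
  obtain ⟨q, hq⟩ := h
  rcases List.append_eq_append_iff.1 hq with ⟨r, rfl, -⟩ | ⟨r, rfl, rfl⟩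
  · exact .inl ⟨r, rfl⟩
  · exact .inr ⟨r, rfl, q, rfl⟩

theorem wordPow_succ {α : Type*} (x : List α) (k : ℕ) : wordPow x (k + 1) = x ++ wordPow x k := by
  simp [wordPow, List.replicate_succ]

namespace Tagging

variable {α : Type*}

/-- The contribution of a symbol to the nesting depth. -/
def weight (t : Tagging α) (c : α) : ℤ :=
  match t.kind c with
  | .plain => 0
  | .call => 1
  | .ret => -1

/-- The number of calls minus the number of returns. -/
def height (t : Tagging α) (s : List α) : ℤ := (s.map t.weight).sum

variable {t : Tagging α}

theorem weight_plain {c : α} (h : t.kind c = .plain) : t.weight c = 0 := by simp [weight, h]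

theorem weight_call {c : α} (h : t.kind c = .call) : t.weight c = 1 := by simp [weight, h]

theorem weight_ret {c : α} (h : t.kind c = .ret) : t.weight c = -1 := by simp [weight, h]

theorem abs_weight_le (t : Tagging α) (c : α) : |t.weight c| ≤ 1 := by
  cases h : t.kind c <;> simp [weight, h]

@[simp]
theorem height_nil : t.height [] = 0 := rfl

@[simp]
theorem height_cons (c : α) (s : List α) : t.height (c :: s) = t.weight c + t.height s := by
  simp [height]

@[simp]
theorem height_append (s s' : List α) : t.height (s ++ s') = t.height s + t.height s' := by
  simp [height]

theorem height_wordPow (x : List α) (k : ℕ) : t.height (wordPow x k) = k * t.height x := by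
  induction k with
  | zero => simp [wordPow]
  | succ k ih =>
    rw [wordPow_succ, height_append, ih]
    push_cast
    ring

theorem WellMatched.height_eq_zero {s : List α} (h : t.WellMatched s) : t.height s = 0 := by
  induction h with
  | nil => rfl
  | plain c s hc _ ih => simp [weight_plain hc, ih]
  | matched a b s₁ s₂ hab _ _ ih₁ ih₂ =>
    simp [weight_call (t.kind_left a b hab), weight_ret (t.kind_right a b hab), ih₁, ih₂]

theorem WellMatched.height_prefix_nonneg {s : List α} (h : t.WellMatched s) {p : List α}
    (hp : p <+: s) : 0 ≤ t.height p := by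
  induction h generalizing p with
  | nil => simp [List.prefix_nil.1 hp]
  | plain c s hc _ ih =>
    rcases List.prefix_cons_iff.1 hp with rfl | ⟨p', rfl, hp'⟩
    · simp
    · simpa [weight_plain hc] using ih hp'
  | matched a b s₁ s₂ hab h₁ _ ih₁ ih₂ =>
    have ha := weight_call (t.kind_left a b hab)
    have hb := weight_ret (t.kind_right a b hab)
    rcases List.prefix_cons_iff.1 hp with rfl | ⟨p', rfl, hp'⟩
    · simp
    rcases List.isPrefix_append_cases hp' with h | ⟨r, rfl, hr⟩
    · have := ih₁ h
      rw [height_cons, ha]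
      omega
    rcases List.prefix_cons_iff.1 hr with rfl | ⟨r', rfl, hr'⟩
    · simp [ha, h₁.height_eq_zero]
    · simpa [ha, hb, h₁.height_eq_zero] using ih₂ hr'

theorem WellMatched.exists_matching_ret {s : List α} (h : t.WellMatched s) {p q : List α} {a : α}
    (hs : s = p ++ a :: q) (ha : t.kind a = .call) :
    ∃ m b r, q = m ++ b :: r ∧ t.WellMatched m ∧ t.pair a b := by
  induction h generalizing p q with
  | nil => simp at hs
  | plain c s hc _ ih =>
    cases p with
    | nil =>
      obtain ⟨rfl, rfl⟩ := List.cons.inj hs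
      simp [hc] at ha
    | cons d p => exact ih (List.cons.inj hs).2
  | matched a' b s₁ s₂ hab h₁ _ ih₁ ih₂ =>
    cases p with
    | nil =>
      obtain ⟨rfl, rfl⟩ := List.cons.inj hs
      exact ⟨s₁, b, s₂, rfl, h₁, hab⟩
    | cons d p =>
      rcases List.append_eq_append_iff.1 (List.cons.inj hs).2 with ⟨r, rfl, hr⟩ | ⟨r, rfl, hr⟩
      · cases r with
        | nil =>
          obtain ⟨rfl, rfl⟩ := List.cons.inj hr
          simp [t.kind_right _ _ hab] at ha
        | cons e r => exact ih₂ (List.cons.inj hr).2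
      · cases r with
        | nil =>
          obtain ⟨rfl, rfl⟩ := List.cons.inj hr
          simp [t.kind_right _ _ hab] at ha
        | cons e r =>
          obtain ⟨rfl, rfl⟩ := List.cons.inj hr
          obtain ⟨m, b', r', rfl, hm, hp⟩ := ih₁ rfl
          exact ⟨m, b', r' ++ b :: s₂, by simp, hm, hp⟩

/-- A balanced factor of a well-matched word has no unmatched call. -/
theorem WellMatched.not_hasUnmatchedCall {p x q : List α} (h : t.WellMatched (p ++ x ++ q))
    (hx : t.height x = 0) (hpre : ∀ r, r <+: x → 0 ≤ t.height r) (a : α) :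
    ¬ t.HasUnmatchedCall a x := by
  rintro ⟨ha, p', q', rfl, hn⟩
  obtain ⟨m, b, r, hr, hm, hab⟩ := h.exists_matching_ret (p := p ++ p') (q := q' ++ q) (a := a)
    (by simp) ha
  have h₁ := hpre p' ⟨_, rfl⟩
  simp only [height_append, height_cons, weight_call ha] at hx
  rcases List.append_eq_append_iff.1 hr with ⟨l, rfl, hl⟩ | ⟨l, rfl, hl⟩
  · have := hm.height_prefix_nonneg (List.prefix_append q' l)
    omega
  · cases l with
    -- The matching return would come directly after `x`, so `q'` has height zero; the call before
    -- it then makes the height of `x` positive.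
    | nil =>
      have := hm.height_eq_zero
      simp only [List.append_nil] at hx
      omega
    | cons e l =>
      obtain ⟨rfl, rfl⟩ := List.cons.inj hl
      exact hn ⟨m, b, l, rfl, hm, hab⟩

/-- Every word can be cut at a prefix of minimal height. -/
theorem exists_cut (t : Tagging α) (x : List α) : ∃ x₁ x₂, x = x₁ ++ x₂ ∧
    (∀ r, r <+: x₂ → 0 ≤ t.height r) ∧ ∀ r r', x₁ = r ++ r' → t.height r' ≤ 0 := by
  induction x with
  | nil => exact ⟨[], [], rfl, by simp, by simp⟩
  | cons c x ih =>
    obtain ⟨x₁, x₂, rfl, h₂, h₁⟩ := ih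
    by_cases hc : t.height (c :: x₁) ≤ 0
    · refine ⟨c :: x₁, x₂, rfl, h₂, fun r r' hr ↦ ?_⟩
      cases r with
      | nil =>
        obtain rfl : c :: x₁ = r' := hr
        exact hc
      | cons d r => exact h₁ r r' (List.cons.inj hr).2
    · refine ⟨[], c :: (x₁ ++ x₂), rfl, fun r hr ↦ ?_, by simp⟩
      rw [height_cons] at hc
      rcases List.prefix_cons_iff.1 hr with rfl | ⟨r, rfl, hr'⟩
      · simp
      rcases List.isPrefix_append_cases hr' with ⟨r', rfl⟩ | ⟨r', rfl, h₃⟩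
      · have := h₁ r r' rfl
        simp only [height_append, height_cons] at *
        omega
      · have := h₂ _ h₃
        simp only [height_append, height_cons] at *
        omega

end Tagging

/-! ### Nesting patterns under a compatible tagging. -/

theorem wordPow_succ' {α : Type*} (x : List α) (k : ℕ) :
    wordPow x (k + 1) = wordPow x k ++ x := by
  simp [wordPow, List.replicate_succ']

theorem append_wordPow_append {α : Type*} (x₁ x₂ : List α) (k : ℕ) :
    x₁ ++ wordPow (x₂ ++ x₁) k ++ x₂ = wordPow (x₁ ++ x₂) (k + 1) := by
  induction k with
  | zero => simp [wordPow]
  | succ k ih =>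
    rw [wordPow_succ, wordPow_succ _ (k + 1), ← ih]
    simp

namespace IsNestingPattern

variable {α : Type*} {L : Language α} {t : Tagging α} {u x z y v : List α}

/-- Rotating the left repeated part of a nesting pattern gives a nesting pattern. -/
theorem rotate {x₁ x₂ : List α} (h : IsNestingPattern L u (x₁ ++ x₂) z y v) :
    IsNestingPattern L (u ++ x₁) (x₂ ++ x₁) (x₂ ++ z ++ y) y v := by
  -- Conjugation raises the exponent on the left by one; the extra `y` in the middle raises the
  -- exponent on the right to match.
  have key (k j : ℕ) : u ++ x₁ ++ wordPow (x₂ ++ x₁) k ++ (x₂ ++ z ++ y) ++ wordPow y j ++ v =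
      u ++ wordPow (x₁ ++ x₂) (k + 1) ++ z ++ wordPow y (j + 1) ++ v := by
    rw [← append_wordPow_append, wordPow_succ y]
    simp
  have hpump (k : ℕ) (_ : 1 ≤ k) :
      u ++ x₁ ++ wordPow (x₂ ++ x₁) k ++ (x₂ ++ z ++ y) ++ wordPow y k ++ v ∈ L := by
    rw [key]
    exact h.pump _ (by omega)
  refine ⟨by simpa [wordPow] using hpump 1 le_rfl, ?_, h.right_ne_nil, hpump, fun k j hkj ↦ ?_⟩
  · have := h.left_ne_nil
    simp only [ne_eq, List.append_eq_nil_iff] at this ⊢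
    tauto
  · rw [key]
    exact h.unbalanced _ _ (by omega)

/-- Under a compatible tagging, the left repeated part of a nesting pattern has more calls than
returns. -/
theorem height_pos (h : IsNestingPattern L u x z y v) (ht : t.Compatible L) :
    0 < t.height x := by
  have hwm (s : List α) (hs : s ∈ L) : t.WellMatched s := (ht s hs).1 s rfl
  have hnonneg : 0 ≤ t.height x := by
    by_contra hneg
    -- With more than `t.height u` copies of a part of negative height, a prefix of a word of `L`
    -- falls below height zero.
    set k := (t.height u).toNat + 1
    have hk := (hwm _ (h.pump k (by omega))).height_prefix_nonneg (p := u ++ wordPow x k)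
      ⟨z ++ wordPow y k ++ v, by simp⟩
    rw [Tagging.height_append, Tagging.height_wordPow] at hk
    have h₁ : (k : ℤ) * t.height x ≤ k * (-1) :=
      mul_le_mul_of_nonneg_left (by omega) (by omega)
    omega
  refine lt_of_le_of_ne hnonneg fun h₀ ↦ ?_
  -- At height zero, rotating `x` to start at its lowest point makes all its prefixes nonnegative.
  -- The rotated part has no unmatched call, against compatibility with the rotated pattern.
  obtain ⟨x₁, x₂, rfl, h₂, h₁⟩ := t.exists_cut x
  have hr := h.rotate
  obtain ⟨a, b, -, ha, -⟩ := (ht _ hr.mem).2 _ _ _ _ _ rfl hr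
  have hw := hwm _ hr.mem
  rw [List.append_assoc, List.append_assoc] at hw
  rw [Tagging.height_append] at h₀
  refine hw.not_hasUnmatchedCall (by simp; omega) (fun r hr ↦ ?_) a ha
  rcases List.isPrefix_append_cases hr with hr | ⟨r, rfl, ⟨r', rfl⟩⟩
  · exact h₂ r hr
  · have := h₁ r r' rfl
    simp only [Tagging.height_append] at *
    omega

end IsNestingPattern

/-! ### Loops of the automaton as nesting patterns. -/

namespace ContextFreeGrammar

variable {α : Type*} {G : ContextFreeGrammar (TaggedSymbol α)} {t : Tagging α}

theorem kind_of_rule (hT : G.TerminalsIn t.terminals)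
    {r : ContextFreeRule (TaggedSymbol α) G.NT} (hr : r ∈ G.rules) {k : SymbolKind} {c : α}
    (hc : Symbol.terminal (k, c) ∈ r.output) : t.kind c = k :=
  congrArg Prod.fst (symbol_of_rule hT hr hc)

theorem Frame.kind_call (hT : G.TerminalsIn t.terminals) (f : G.Frame) : t.kind f.call = .call :=
  kind_of_rule hT f.mem (by simp)

theorem Frame.kind_ret (hT : G.TerminalsIn t.terminals) (f : G.Frame) : t.kind f.ret = .ret :=
  kind_of_rule hT f.mem (by simp)

theorem Gen.height_eq_zero (hT : G.TerminalsIn t.terminals) {A : G.NT} {s : List α}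
    (h : G.Gen A s) : t.height s = 0 := by
  induction h with
  | eps => rfl
  | plain A B c s hr _ ih =>
    simp [Tagging.weight_plain (kind_of_rule (k := .plain) (c := c) hT hr (by simp)), ih]
  | matched A B C a b s₁ s₂ hr _ _ ih₁ ih₂ =>
    simp [Tagging.weight_call (kind_of_rule (k := .call) (c := a) hT hr (by simp)),
      Tagging.weight_ret (kind_of_rule (k := .ret) (c := b) hT hr (by simp)), ih₁, ih₂]

theorem Tail.height_eq (hT : G.TerminalsIn t.terminals) {γ : List G.Frame} {y : List α}
    (h : G.Tail γ y) : t.height y = -γ.length := by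
  induction γ generalizing y with
  | nil => cases h; rfl
  | cons f γ ih =>
    obtain ⟨z, y', rfl, hz, hy⟩ := h
    simp [Tagging.weight_ret (f.kind_ret hT), hz.height_eq_zero hT, ih hy]

theorem Run.height_eq (hT : G.TerminalsIn t.terminals) {p q : G.NT × List G.Frame} {u : List α}
    (h : G.Run p u q) : t.height u = q.2.length - p.2.length := by
  induction u generalizing p with
  | nil => cases h; simp
  | cons c u ih =>
    obtain ⟨A, γ⟩ := p
    obtain ⟨r, hs, hr⟩ := h
    have := ih hr
    rcases hs with ⟨B, hB, rfl⟩ | ⟨f, rfl, rfl, rfl⟩ | ⟨f, γ', hA, hγ, rfl, rfl⟩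
    · simp [Tagging.weight_plain (kind_of_rule (k := .plain) (c := c) hT hB (by simp)), this]
    · simp only [Tagging.height_cons, Tagging.weight_call (f.kind_call hT), this, List.length_cons]
      push_cast
      ring
    · simp only at hγ
      simp only [Tagging.height_cons, Tagging.weight_ret (f.kind_ret hT), this, hγ,
        List.length_cons]
      push_cast
      ring

theorem Gen.wrap {X Y : G.NT} {γ : List G.Frame} {x z y : List α} (hr : G.Run (X, []) x (Y, γ))
    (hz : G.Gen Y z) (hy : G.Tail γ y) : G.Gen X (x ++ z ++ y) := by
  rw [List.append_assoc]
  exact acc_nil_iff.1 (acc_append_iff.2 ⟨_, hr, z, y, rfl, hz, hy⟩)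

theorem Gen.pump {Y : G.NT} {γ : List G.Frame} {x z y : List α} (hr : G.Run (Y, []) x (Y, γ))
    (hz : G.Gen Y z) (hy : G.Tail γ y) (k : ℕ) : G.Gen Y (wordPow x k ++ z ++ wordPow y k) := by
  induction k with
  | zero => simpa [wordPow] using hz
  | succ k ih =>
    rw [wordPow_succ, wordPow_succ']
    simpa using ih.wrap hr hy

variable {L : Language α} {tO : Tagging α}

/-- A loop of the pushdown automaton that grows the stack gives a nesting pattern. -/
theorem isNestingPattern_of_loop (hT : G.TerminalsIn tO.terminals)
    (hL : ∀ s, s ∈ L ↔ G.Gen G.initial s) {Y : G.NT} {γ δ : List G.Frame} {u x z y v : List α}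
    (hu : G.Run (G.initial, []) u (Y, δ)) (hx : G.Run (Y, []) x (Y, γ)) (hγ : γ ≠ [])
    (hz : G.Gen Y z) (hy : G.Tail γ y) (hv : G.Tail δ v) : IsNestingPattern L u x z y v := by
  have hpump (k : ℕ) : u ++ wordPow x k ++ z ++ wordPow y k ++ v ∈ L := by
    rw [hL]
    simpa using (hz.pump hx hy k).wrap hu hv
  have hxh := hx.height_eq hT
  have hyh := hy.height_eq hT
  have hpos : 0 < γ.length := List.length_pos_iff.2 hγ
  simp only [List.length_nil] at hxh
  refine ⟨by simpa [wordPow] using hpump 1, ?_, ?_, fun k _ ↦ hpump k, fun k j hkj hmem ↦ ?_⟩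
  · rintro rfl
    rw [Tagging.height_nil] at hxh
    omega
  · rintro rfl
    rw [Tagging.height_nil] at hyh
    omega
  -- The heights here are those of `tO`: `x` and `y` have heights `γ.length` and `-γ.length`, so
  -- only equal exponents give total height zero.
  · have h₁ := ((hL _).1 hmem).height_eq_zero hT
    have h₂ := ((hL _).1 (hpump k)).height_eq_zero hT
    simp only [Tagging.height_append, Tagging.height_wordPow, hyh] at h₁ h₂
    have h₃ : (k : ℤ) * γ.length = j * γ.length := by linarith
    exact hkj (by exact_mod_cast mul_right_cancel₀ (by exact_mod_cast hpos.ne') h₃)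

/-- The words with and without the loop both lie in `L` and have height zero under `t`, so the
heights of `x` and `y` cancel; that of `x` is positive by `IsNestingPattern.height_pos`. -/
theorem height_tail_of_loop (hT : G.TerminalsIn tO.terminals)
    (hL : ∀ s, s ∈ L ↔ G.Gen G.initial s) (ht : t.Compatible L) {Y : G.NT}
    {γ δ : List G.Frame} {u x z y v : List α}
    (hu : G.Run (G.initial, []) u (Y, δ)) (hx : G.Run (Y, []) x (Y, γ)) (hγ : γ ≠ [])
    (hz : G.Gen Y z) (hy : G.Tail γ y) (hv : G.Tail δ v) : t.height y ≤ -1 := by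
  have hpos := (isNestingPattern_of_loop hT hL hu hx hγ hz hy hv).height_pos ht
  have hzero (s : List α) (hs : G.Gen G.initial s) : t.height s = 0 :=
    ((ht s ((hL s).2 hs)).1 s rfl).height_eq_zero
  have h₁ := hzero _ (hz.wrap hu hv)
  have h₂ := hzero _ ((hz.wrap hx hy).wrap hu hv)
  simp only [Tagging.height_append] at h₁ h₂
  omega

end ContextFreeGrammar


/-! ### Lists over a finite set with negative loops. -/

/-- If the last entry occurred before, cutting out the loop only increases the sum; otherwise it is
a new value and contributes at most `c`. -/
theorem List.sum_map_le_of_loops_neg {F : Type*} [DecidableEq F] {g : F → ℤ} {c : ℕ}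
    (hg : ∀ f, g f ≤ c) (l : List F)
    (hl : ∀ l₁ f l₂ l₃, l = l₁ ++ f :: (l₂ ++ f :: l₃) → ((l₂ ++ [f]).map g).sum ≤ -1) :
    (l.map g).sum ≤ c * l.toFinset.card := by
  induction hn : l.length using Nat.strong_induction_on generalizing l with
  | _ n ih =>
  rcases l.eq_nil_or_concat' with rfl | ⟨l, f, rfl⟩
  · simp
  by_cases hf : f ∈ l
  · obtain ⟨l₁, l₂, rfl⟩ := List.append_of_mem hf
    have h₁ := hl l₁ f l₂ [] (by simp)
    have h₂ := ih (l₁ ++ [f]).length (by simp at hn ⊢; omega) (l₁ ++ [f])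
      (fun m₁ f' m₂ m₃ h ↦ hl m₁ f' m₂ (m₃ ++ (l₂ ++ [f])) (by
        have := congrArg (· ++ (l₂ ++ [f])) h
        simpa using this)) rfl
    have h₃ : (l₁ ++ [f]).toFinset.card ≤ (l₁ ++ f :: l₂ ++ [f]).toFinset.card := by
      apply Finset.card_le_card
      intro x
      simp
      tauto
    have h₄ : (c : ℤ) * (l₁ ++ [f]).toFinset.card ≤
        c * (l₁ ++ f :: l₂ ++ [f]).toFinset.card := by
      exact_mod_cast Nat.mul_le_mul_left c h₃
    simp only [List.map_append, List.map_cons, List.sum_append, List.sum_cons, List.map_nil,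
      List.sum_nil] at h₁ h₂ h₄ ⊢
    linarith
  · have h₂ := ih l.length (by simp at hn; omega) l
      (fun m₁ f' m₂ m₃ h ↦ hl m₁ f' m₂ (m₃ ++ [f]) (by simp [h])) rfl
    have h₃ : (l ++ [f]).toFinset.card = l.toFinset.card + 1 := by
      rw [List.toFinset_append, List.toFinset_cons, List.toFinset_nil, Finset.union_comm]
      simp [hf]
    rw [h₃]
    have := hg f
    simp only [List.map_append, List.map_cons, List.sum_append, List.sum_cons, List.map_nil,
      List.sum_nil]
    push_cast
    linarith

/-- `V` collects, for every nonempty prefix, its last entry and its sum. These pairs are distinct,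
since the sum strictly decreases whenever an entry recurs. -/
theorem List.exists_finset_of_loops_neg {F : Type*} [DecidableEq F] {g : F → ℤ} (l : List F)
    (hl : ∀ l₁ f l₂ l₃, l = l₁ ++ f :: (l₂ ++ f :: l₃) → ((l₂ ++ [f]).map g).sum ≤ -1) :
    ∃ V : Finset (F × ℤ), V.card = l.length ∧
      ∀ x ∈ V, ∃ l₁, l₁ ++ [x.1] <+: l ∧ x.2 = ((l₁ ++ [x.1]).map g).sum := by
  induction l using List.reverseRecOn with
  | nil => exact ⟨∅, by simp⟩
  | append_singleton l f ih =>
    obtain ⟨V, hV, hx⟩ := ih fun m₁ f' m₂ m₃ h ↦ hl m₁ f' m₂ (m₃ ++ [f]) (by simp [h])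
    refine ⟨insert (f, ((l ++ [f]).map g).sum) V, ?_, ?_⟩
    · rw [Finset.card_insert_of_notMem, hV, List.length_append, List.length_singleton]
      intro h
      obtain ⟨l₁, ⟨l₂, h'⟩, hs⟩ := hx _ h
      simp only at h' hs
      subst h'
      have := hl l₁ f l₂ [] (by simp)
      simp only [List.map_append, List.map_cons, List.sum_append, List.sum_cons, List.map_nil,
        List.sum_nil] at hs this
      linarith
    · simp only [Finset.mem_insert, forall_eq_or_imp]
      refine ⟨⟨l, List.prefix_rfl, rfl⟩, fun x h ↦ ?_⟩
      obtain ⟨l₁, h₁, h₂⟩ := hx x h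
      exact ⟨l₁, h₁.trans (List.prefix_append _ _), h₂⟩

/-- A list whose loops have negative weight and whose prefixes have bounded negative weight is
bounded in length. -/
theorem List.exists_length_le_of_loops_neg (F : Type*) [Finite F] (c D : ℕ) :
    ∃ K : ℕ, ∀ (g : F → ℤ) (l : List F), (∀ f, g f ≤ c) →
      (∀ l₁, l₁ <+: l → -(D : ℤ) ≤ (l₁.map g).sum) →
      (∀ l₁ f l₂ l₃, l = l₁ ++ f :: (l₂ ++ f :: l₃) → ((l₂ ++ [f]).map g).sum ≤ -1) →
      l.length ≤ K := by
  classical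
  have := Fintype.ofFinite F
  -- The bound counts the possible pairs of last entry and prefix sum.
  refine ⟨((Finset.univ : Finset F) ×ˢ
    Finset.Icc (-(D : ℤ)) (c * Fintype.card F)).card, fun g l hg hD hl ↦ ?_⟩
  obtain ⟨V, hV, hx⟩ := l.exists_finset_of_loops_neg hl
  rw [← hV]
  refine Finset.card_le_card fun x h ↦ ?_
  obtain ⟨l₁, h₁, h₂⟩ := hx x h
  obtain ⟨l₂, h₁'⟩ := h₁
  simp only [Finset.mem_product, Finset.mem_univ, true_and, Finset.mem_Icc]
  refine ⟨h₂ ▸ hD _ ⟨l₂, h₁'⟩, ?_⟩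
  rw [h₂]
  refine (List.sum_map_le_of_loops_neg hg _ fun m₁ f m₂ m₃ h ↦
    hl m₁ f m₂ (m₃ ++ l₂) (by simp [← h₁', h])).trans ?_
  exact_mod_cast Nat.mul_le_mul_left c (Finset.card_le_univ _)

/-! ### Heights of configurations and the bound on stack changes. -/

namespace ContextFreeGrammar

variable {α : Type*} {G : ContextFreeGrammar (TaggedSymbol α)} {t tO : Tagging α}
  {L : Language α}

open Classical in
/-- The height under `t` of some word generated from `A`. -/
noncomputable def genHeight (G : ContextFreeGrammar (TaggedSymbol α)) (t : Tagging α) (A : G.NT) :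
    ℤ :=
  if h : ∃ s, G.Gen A s then t.height h.choose else 0

/-- The height under `t` of a word that completes the rule `f` after its inner nonterminal. -/
noncomputable def frameHeight (G : ContextFreeGrammar (TaggedSymbol α)) (t : Tagging α)
    (f : G.Frame) : ℤ :=
  t.weight f.ret + G.genHeight t f.next

/-- The height under `t` of a word accepted from the configuration `p`. -/
noncomputable def configHeight (G : ContextFreeGrammar (TaggedSymbol α)) (t : Tagging α)
    (p : G.NT × List G.Frame) : ℤ :=
  G.genHeight t p.1 + (p.2.map (G.frameHeight t)).sum

theorem Gen.exists_rule {A : G.NT} {s : List α} (h : G.Gen A s) : ∃ r ∈ G.rules, r.input = A := by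
  cases h with
  | eps _ hr => exact ⟨_, hr, rfl⟩
  | plain _ _ _ _ hr => exact ⟨_, hr, rfl⟩
  | matched _ _ _ _ _ _ _ hr => exact ⟨_, hr, rfl⟩

/-- `G.NT` may be infinite, but only left-hand sides of the finitely many rules generate a word;
elsewhere `genHeight` has its default value zero. -/
theorem exists_abs_genHeight_le (G : ContextFreeGrammar (TaggedSymbol α)) (t : Tagging α) :
    ∃ c : ℕ, ∀ A, |G.genHeight t A| ≤ c := by
  refine ⟨∑ r ∈ G.rules, (G.genHeight t r.input).natAbs, fun A ↦ ?_⟩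
  by_cases h : ∃ s, G.Gen A s
  · obtain ⟨s, hs⟩ := h
    obtain ⟨r, hr, rfl⟩ := hs.exists_rule
    rw [Int.abs_eq_natAbs]
    exact_mod_cast Finset.single_le_sum (f := fun r ↦ (G.genHeight t r.input).natAbs)
      (fun _ _ ↦ Nat.zero_le _) hr
  · simp only [genHeight, h, dif_neg, not_false_eq_true, abs_zero]
    positivity

theorem Gen.exists_run {A : G.NT} {z : List α} (h : G.Gen A z) :
    ∃ B, G.Run (A, []) z (B, []) ∧ ⟨B, []⟩ ∈ G.rules := by
  rw [← acc_nil_iff, ← z.append_nil, acc_append_iff] at h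
  obtain ⟨⟨B, γ⟩, hr, z', y, he, hz, hy⟩ := h
  obtain ⟨rfl, rfl⟩ := List.append_eq_nil_iff.1 he.symm
  cases γ with
  | nil =>
    cases hz with
    | eps _ hB => exact ⟨B, hr, hB⟩
  | cons f γ => obtain ⟨_, _, h, -⟩ := hy; cases h

/-- All words generated from the leftmost nonterminal of a useful configuration have the same
height. -/
theorem Gen.height_eq_genHeight (hL : ∀ s, G.Gen G.initial s → t.height s = 0)
    {A : G.NT} {γ : List G.Frame} {u z y : List α} (hu : G.Run (G.initial, []) u (A, γ))
    (hz : G.Gen A z) (hy : G.Tail γ y) : t.height z = G.genHeight t A := by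
  have h : ∃ s, G.Gen A s := ⟨z, hz⟩
  have h₁ := hL _ (hz.wrap hu hy)
  have h₂ := hL _ (h.choose_spec.wrap hu hy)
  simp only [Tagging.height_append] at h₁ h₂
  rw [genHeight, dif_pos h]
  omega

/-- Reading `z` and the return symbol of the top frame leads to another reachable configuration, so
`Gen.height_eq_genHeight` applies frame by frame. -/
theorem Tail.height_eq_sum (hL : ∀ s, G.Gen G.initial s → t.height s = 0)
    {A : G.NT} {γ : List G.Frame} {u z y : List α} (hu : G.Run (G.initial, []) u (A, γ))
    (hz : G.Gen A z) (hy : G.Tail γ y) : t.height y = (γ.map (G.frameHeight t)).sum := by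
  induction γ generalizing A u z y with
  | nil => cases hy; rfl
  | cons f γ ih =>
    obtain ⟨z', y', rfl, hz', hy'⟩ := hy
    obtain ⟨B, hB, hr⟩ := hz.exists_run
    have hrun : G.Run (G.initial, []) (u ++ (z ++ [f.ret])) (f.next, γ) :=
      run_append_iff.2 ⟨_, hu, run_append_iff.2 ⟨_, hB.append_stack (f :: γ),
        run_singleton_iff.2 (.inr (.inr ⟨f, γ, hr, rfl, rfl, rfl⟩))⟩⟩
    simp [ih hrun hz' hy', hz'.height_eq_genHeight hL hrun hy', frameHeight, add_assoc]

theorem Acc.height_eq (hL : ∀ s, G.Gen G.initial s → t.height s = 0)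
    {p : G.NT × List G.Frame} {u v : List α} (hu : G.Run (G.initial, []) u p)
    (hv : G.Acc p v) : t.height v = G.configHeight t p := by
  obtain ⟨z, y, rfl, hz, hy⟩ := hv
  rw [Tagging.height_append, hz.height_eq_genHeight hL hu hy, hy.height_eq_sum hL hu hz,
    configHeight]

/-- `configHeight` is a potential for the `t`-height along accepting runs. This relates
well-matchedness under `t` to the stack, which obeys `tO`. -/
theorem Run.height_eq_sub (hL : ∀ s, G.Gen G.initial s → t.height s = 0)
    {p q : G.NT × List G.Frame} {u w v : List α} (hu : G.Run (G.initial, []) u p)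
    (hw : G.Run p w q) (hv : G.Acc q v) :
    t.height w = G.configHeight t p - G.configHeight t q := by
  have h₁ := hv.height_eq hL (run_append_iff.2 ⟨p, hu, hw⟩)
  have h₂ := (acc_append_iff.2 ⟨q, hw, hv⟩).height_eq hL hu
  rw [Tagging.height_append] at h₂
  omega

/-- Between two occurrences of a rule on the stack the heights add up to a negative number. -/
theorem sum_frameHeight_of_loop (hT : G.TerminalsIn tO.terminals)
    (hL : ∀ s, s ∈ L ↔ G.Gen G.initial s) (ht : t.Compatible L) {A : G.NT}
    {γ₁ γ₂ γ₃ : List G.Frame} {f : G.Frame} {u v : List α}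
    (hu : G.Run (G.initial, []) u (A, γ₁ ++ f :: (γ₂ ++ f :: γ₃)))
    (hv : G.Acc (A, γ₁ ++ f :: (γ₂ ++ f :: γ₃)) v) :
    ((γ₂ ++ [f]).map (G.frameHeight t)).sum ≤ -1 := by
  have hzero (s : List α) (hs : G.Gen G.initial s) : t.height s = 0 :=
    ((ht s ((hL s).2 hs)).1 s rfl).height_eq_zero
  -- The upper occurrence of `f` is located first, then the lower one. Between the two pushes the
  -- run leads from `f.lhs` back to `f.lhs` and adds `γ₂ ++ [f]` to the stack.
  obtain ⟨p, q, rfl, hp, hq⟩ := hu.exists_push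
  obtain ⟨p', q', rfl, hp', hq'⟩ := hp.exists_push
  have hacc : G.Acc (f.lhs, γ₂ ++ f :: γ₃) ((f.call :: q) ++ v) := by
    refine acc_append_iff.2 ⟨_, ⟨_, .inr (.inl ⟨f, rfl, rfl, rfl⟩), ?_⟩, hv⟩
    exact hq.append_stack (f :: (γ₂ ++ f :: γ₃))
  obtain ⟨z, y, -, hz, hy⟩ := hacc
  have hsum := hy.height_eq_sum hzero hp hz
  have he : γ₂ ++ f :: γ₃ = γ₂ ++ [f] ++ γ₃ := by simp
  simp only [he] at hy hsum
  obtain ⟨y₁, y₂, rfl, hy₁, hy₂⟩ := tail_append_iff.1 hy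
  have hx : G.Run (f.lhs, []) (f.call :: q') (f.lhs, γ₂ ++ [f]) :=
    ⟨_, .inr (.inl ⟨f, rfl, rfl, rfl⟩), hq'.append_stack [f]⟩
  have h₁ := height_tail_of_loop hT hL ht hp' hx (by simp) hz hy₁ hy₂
  have h₂ := hy₂.height_eq_sum hzero hp' hz
  rw [Tagging.height_append, List.map_append, List.sum_append] at hsum
  omega

/-- On a well-matched factor of a word of `L`, the pushdown automaton pops and pushes boundedly
many symbols. -/
theorem exists_bounded_pop_push (hT : G.TerminalsIn tO.terminals)
    (hL : ∀ s, s ∈ L ↔ G.Gen G.initial s) (ht : t.Compatible L) :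
    ∃ K : ℕ, ∀ (u w v : List α) (p q : G.NT × List G.Frame), t.WellMatched w →
      G.Run (G.initial, []) u p → G.Run p w q → G.Acc q v →
      ∃ pop push δ : List G.Frame, p.2 = pop ++ δ ∧ q.2 = push ++ δ ∧ pop.length ≤ K ∧
        push.length ≤ K ∧ G.Run (p.1, pop) w (q.1, push) := by
  have hzero (s : List α) (hs : G.Gen G.initial s) : t.height s = 0 :=
    ((ht s ((hL s).2 hs)).1 s rfl).height_eq_zero
  obtain ⟨c, hc⟩ := G.exists_abs_genHeight_le t
  -- A frame height is a symbol weight, at most `1`, plus a `genHeight`, at most `c`. A prefix sum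
  -- below is a nonnegative height plus a difference of two values of `genHeight`, hence at least
  -- `-2c`.
  obtain ⟨K, hK⟩ := List.exists_length_le_of_loops_neg G.Frame (c + 1) (2 * c)
  have hg (f : G.Frame) : G.frameHeight t f ≤ (c + 1 : ℕ) := by
    have h₁ := (abs_le.1 (hc f.next)).2
    have h₂ := (abs_le.1 (t.abs_weight_le f.ret)).2
    rw [frameHeight]
    push_cast
    omega
  refine ⟨K, fun u w v p q hw hu hpq hv ↦ ?_⟩
  obtain ⟨A, γ⟩ := p
  obtain ⟨B, γ'⟩ := q
  obtain ⟨pop, push, δ, Z, w₁, w₂, h₁, h₂, rfl, hr₁, hr₂⟩ := hpq.exists_pop_push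
  simp only at h₁ h₂ hr₁ hr₂
  subst h₁ h₂
  have hr₁' := hr₁.append_stack δ
  have hr₂' := hr₂.append_stack δ
  refine ⟨pop, push, δ, rfl, rfl, ?_, ?_, run_append_iff.2 ⟨_, hr₁, hr₂⟩⟩
  · refine hK (G.frameHeight t) pop hg (fun l hl ↦ ?_) fun l₁ f l₂ l₃ h ↦ ?_
    · obtain ⟨m, rfl⟩ := hl
      rcases l.eq_nil_or_concat' with rfl | ⟨l, f, rfl⟩
      · simp
      simp only [List.append_assoc, List.singleton_append] at hr₁
      -- The prefix `w'` of the well-matched word pops exactly `l ++ [f]`, and its height is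
      -- nonnegative.
      obtain ⟨w', w'', rfl, hw', hrest⟩ := hr₁.exists_pop_prefix
      have hw'' := hw'.append_stack (m ++ δ)
      have hv' : G.Acc (f.next, m ++ δ) (w'' ++ (w₂ ++ v)) :=
        acc_append_iff.2 ⟨_, hrest.append_stack δ, acc_append_iff.2 ⟨_, hr₂', hv⟩⟩
      have h := Run.height_eq_sub hzero (by simpa using hu) hw'' hv'
      have hpos := hw.height_prefix_nonneg (p := w') ⟨w'' ++ w₂, by simp⟩
      have h₁ := abs_le.1 (hc A)
      have h₂ := abs_le.1 (hc f.next)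
      simp only [configHeight, List.map_append, List.sum_append, List.nil_append] at h ⊢
      push_cast
      omega
    · subst h
      exact sum_frameHeight_of_loop hT hL ht (by simpa using hu)
        (by simpa using acc_append_iff.2 ⟨_, hpq, hv⟩)
  · refine hK (G.frameHeight t) push hg (fun l hl ↦ ?_) fun l₁ f l₂ l₃ h ↦ ?_
    · obtain ⟨m, rfl⟩ := hl
      rcases l.eq_nil_or_concat' with rfl | ⟨l, f, rfl⟩
      · simp
      simp only [List.append_assoc, List.singleton_append] at hr₂
      -- The suffix `f.call :: w''` of the well-matched word pushes exactly `l ++ [f]`, and its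
      -- height is at most zero because the prefix before it has nonnegative height.
      obtain ⟨w', w'', rfl, hw', hw''⟩ := hr₂.exists_push
      have hx : G.Run (f.lhs, m ++ δ) (f.call :: w'') (B, l ++ [f] ++ (m ++ δ)) :=
        ⟨_, .inr (.inl ⟨f, rfl, rfl, rfl⟩), by simpa using hw''.append_stack (f :: (m ++ δ))⟩
      have hu' : G.Run (G.initial, []) (u ++ (w₁ ++ w')) (f.lhs, m ++ δ) :=
        run_append_iff.2 ⟨_, hu, run_append_iff.2 ⟨_, hr₁', hw'.append_stack δ⟩⟩
      have h := Run.height_eq_sub hzero hu' hx (v := v) (by simpa using hv)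
      have hpos := hw.height_prefix_nonneg (p := w₁ ++ w') ⟨f.call :: w'', by simp⟩
      have h₀ := hw.height_eq_zero
      have h₁ := abs_le.1 (hc f.lhs)
      have h₂ := abs_le.1 (hc B)
      simp only [configHeight, List.map_append, List.sum_append, Tagging.height_append] at *
      push_cast
      omega
    · subst h
      exact sum_frameHeight_of_loop hT hL ht (run_append_iff.2 ⟨_, hu, by simpa using hpq⟩)
        (by simpa using hv)

end ContextFreeGrammar

/-! ### Context classes of well-matched words. -/

namespace Language

variable {α : Type*}

/-- The contexts that complete `w` to a word of `L`. -/
def contexts (L : Language α) (w : List α) : Set (List α × List α) :=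
  {p | p.1 ++ w ++ p.2 ∈ L}

theorem contexts_append (L : Language α) {w w' : List α} (h : L.contexts w = L.contexts w')
    (u v : List α) : L.contexts (u ++ w ++ v) = L.contexts (u ++ w' ++ v) := by
  ext ⟨x, y⟩
  have := Set.ext_iff.1 h (x ++ u, v ++ y)
  simpa [contexts] using this

theorem mem_iff_of_contexts (L : Language α) {w w' : List α} (h : L.contexts w = L.contexts w') :
    w ∈ L ↔ w' ∈ L := by
  simpa [contexts] using Set.ext_iff.1 h ([], [])

end Language

namespace ContextFreeGrammar

variable {α : Type*} {G : ContextFreeGrammar (TaggedSymbol α)} {t tO : Tagging α}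
  {L : Language α}

/-- The effects of reading `w` on the nonterminal and on at most `K` symbols of the stack. -/
def effects (G : ContextFreeGrammar (TaggedSymbol α)) (K : ℕ) (w : List α) :
    Set ((G.NT × List G.Frame) × (G.NT × List G.Frame)) :=
  {e | G.Run e.1 w e.2 ∧ (∃ r ∈ G.rules, r.input = e.1.1) ∧ (∃ r ∈ G.rules, r.input = e.2.1) ∧
    e.1.2.length ≤ K ∧ e.2.2.length ≤ K}

/-- Requiring both nonterminals to be left-hand sides of rules is what keeps the possible effects
finite in number, as `G.NT` itself need not be finite. -/
theorem finite_range_effects (G : ContextFreeGrammar (TaggedSymbol α)) (K : ℕ) :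
    (Set.range (G.effects K)).Finite := by
  have hI : {A : G.NT | ∃ r ∈ G.rules, r.input = A}.Finite :=
    G.rules.finite_toSet.image ContextFreeRule.input
  have hS : {γ : List G.Frame | γ.length ≤ K}.Finite := List.finite_length_le _ _
  refine ((hI.prod hS).prod (hI.prod hS)).finite_subsets.subset ?_
  rintro _ ⟨w, rfl⟩ e ⟨-, h₁, h₂, h₃, h₄⟩
  exact ⟨⟨h₁, h₃⟩, h₂, h₄⟩

/-- In an accepting run through `w`, the part that reads `w` acts on a bounded top segment of the
stack. By equality of effects it can be replaced by a run on `w'` over the same untouched rest `δ`.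
-/
theorem contexts_subset_of_effects (hL : ∀ s, s ∈ L ↔ G.Gen G.initial s) {K : ℕ}
    (hK : ∀ (u w v : List α) (p q : G.NT × List G.Frame), t.WellMatched w →
      G.Run (G.initial, []) u p → G.Run p w q → G.Acc q v →
      ∃ pop push δ : List G.Frame, p.2 = pop ++ δ ∧ q.2 = push ++ δ ∧ pop.length ≤ K ∧
        push.length ≤ K ∧ G.Run (p.1, pop) w (q.1, push))
    {w w' : List α} (hw : t.WellMatched w) (h : G.effects K w = G.effects K w') :
    L.contexts w ⊆ L.contexts w' := by
  rintro ⟨u, v⟩ huv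
  simp only [Language.contexts, Set.mem_ofPred_eq, List.append_assoc, hL] at huv ⊢
  obtain ⟨p, hu, hp⟩ := acc_append_iff.1 (acc_nil_iff.2 huv)
  obtain ⟨q, hq, hv⟩ := acc_append_iff.1 hp
  obtain ⟨pop, push, δ, h₁, h₂, h₃, h₄, hr⟩ := hK u w v p q hw hu hq hv
  obtain ⟨z, -, -, hz, -⟩ := hp
  obtain ⟨z', -, -, hz', -⟩ := id hv
  have he : ((p.1, pop), (q.1, push)) ∈ G.effects K w :=
    ⟨hr, hz.exists_rule, hz'.exists_rule, h₃, h₄⟩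
  rw [h] at he
  have hr' := he.1.append_stack δ
  rw [← h₁, ← h₂] at hr'
  exact acc_nil_iff.1 (acc_append_iff.2 ⟨p, hu, acc_append_iff.2 ⟨q, hr', hv⟩⟩)

/-- Well-matched words have finitely many context classes. -/
theorem finite_contexts (hT : G.TerminalsIn tO.terminals)
    (hL : ∀ s, s ∈ L ↔ G.Gen G.initial s) (ht : t.Compatible L) :
    (L.contexts '' {w | t.WellMatched w}).Finite := by
  obtain ⟨K, hK⟩ := exists_bounded_pop_push hT hL ht
  -- An effect set is sent to the union of the contexts of all well-matched words that have it;
  -- these contexts coincide, so the union is the context set of any one of them.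
  refine ((G.finite_range_effects K).image
    fun E ↦ {p | ∃ w, t.WellMatched w ∧ G.effects K w = E ∧ p ∈ L.contexts w}).subset ?_
  rintro _ ⟨w, hw, rfl⟩
  refine ⟨G.effects K w, ⟨w, rfl⟩, Set.Subset.antisymm ?_ fun p hp ↦ ⟨w, hw, rfl, hp⟩⟩
  rintro p ⟨w', hw', h, hp⟩
  exact contexts_subset_of_effects hL hK hw' h hp

end ContextFreeGrammar

/-! ### The grammar of context classes. -/

namespace Language

variable {α : Type*}

/-- The words that the nonterminal `A` of the grammar of context classes stands for: the words of
`L`, or the words in one of the classes enumerated by `e`. -/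
def InClass {n : ℕ} (L : Language α) (e : Fin n → Set (List α × List α)) :
    Option (Fin n) → List α → Prop
  | none, w => w ∈ L
  | some i, w => e i = L.contexts w

theorem InClass.congr {L : Language α} {n : ℕ} {e : Fin n → Set (List α × List α)}
    {A : Option (Fin n)} {w w' : List α} (h : L.InClass e A w)
    (hw : L.contexts w = L.contexts w') : L.InClass e A w' := by
  cases A with
  | none => exact (L.mem_iff_of_contexts hw).1 h
  | some i => exact Eq.trans h hw

/-- The rules of the grammar of context classes. -/
def classRules {n : ℕ} (L : Language α) (t : Tagging α) (e : Fin n → Set (List α × List α)) :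
    Set (ContextFreeRule (TaggedSymbol α) (Option (Fin n))) :=
  {r | (∃ A, L.InClass e A [] ∧ r = ⟨A, []⟩) ∨
    (∃ A c i w, t.kind c = .plain ∧ t.WellMatched w ∧ L.InClass e (some i) w ∧
      L.InClass e A (c :: w) ∧
      r = ⟨A, [Symbol.terminal (SymbolKind.plain, c), Symbol.nonterminal (some i)]⟩) ∨
    ∃ A a b i j w w', t.pair a b ∧ t.WellMatched w ∧ t.WellMatched w' ∧
      L.InClass e (some i) w ∧ L.InClass e (some j) w' ∧ L.InClass e A (a :: (w ++ b :: w')) ∧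
      r = ⟨A, [Symbol.terminal (SymbolKind.call, a), Symbol.nonterminal (some i),
        Symbol.terminal (SymbolKind.ret, b), Symbol.nonterminal (some j)]⟩}

theorem finite_classRules [Finite α] {n : ℕ} (L : Language α) (t : Tagging α)
    (e : Fin n → Set (List α × List α)) : (L.classRules t e).Finite := by
  refine ((Set.finite_range fun A : Option (Fin n) ↦
      (⟨A, []⟩ : ContextFreeRule (TaggedSymbol α) _)).union
    ((Set.finite_range fun x : Option (Fin n) × α × Fin n ↦
      (⟨x.1, [Symbol.terminal (SymbolKind.plain, x.2.1), Symbol.nonterminal (some x.2.2)]⟩ :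
        ContextFreeRule (TaggedSymbol α) _)).union
    (Set.finite_range fun x : Option (Fin n) × α × α × Fin n × Fin n ↦
      (⟨x.1, [Symbol.terminal (SymbolKind.call, x.2.1), Symbol.nonterminal (some x.2.2.2.1),
        Symbol.terminal (SymbolKind.ret, x.2.2.1), Symbol.nonterminal (some x.2.2.2.2)]⟩ :
        ContextFreeRule (TaggedSymbol α) _)))).subset ?_
  rintro _ (⟨A, -, rfl⟩ | ⟨A, c, i, w, -, -, -, -, rfl⟩ |
    ⟨A, a, b, i, j, w, w', -, -, -, -, -, -, rfl⟩)
  · exact .inl ⟨A, rfl⟩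
  · exact .inr (.inl ⟨(A, c, i), rfl⟩)
  · exact .inr (.inr ⟨(A, a, b, i, j), rfl⟩)

/-- The grammar of context classes. -/
noncomputable def classGrammar [Finite α] {n : ℕ} (L : Language α) (t : Tagging α)
    (e : Fin n → Set (List α × List α)) : ContextFreeGrammar (TaggedSymbol α) where
  NT := Option (Fin n)
  initial := none
  rules := (L.finite_classRules t e).toFinset

section classGrammar

variable [Finite α] {n : ℕ} {L : Language α} {t : Tagging α} {e : Fin n → Set (List α × List α)}

theorem mem_rules_classGrammar
    {r : ContextFreeRule (TaggedSymbol α) (L.classGrammar t e).NT} :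
    r ∈ (L.classGrammar t e).rules ↔ r ∈ L.classRules t e :=
  Set.Finite.mem_toFinset _

theorem isVPG_classGrammar : (L.classGrammar t e).IsVPG := by
  intro r hr
  rcases mem_rules_classGrammar.1 hr with ⟨A, -, rfl⟩ | ⟨A, c, i, w, -, -, -, -, rfl⟩ |
    ⟨A, a, b, i, j, w, w', -, -, -, -, -, -, rfl⟩
  · exact .inl rfl
  · exact .inr (.inl ⟨c, some i, rfl⟩)
  · exact .inr (.inr ⟨a, b, some i, some j, rfl⟩)

theorem terminalsIn_classGrammar : (L.classGrammar t e).TerminalsIn t.terminals := by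
  have h (r : ContextFreeRule (TaggedSymbol α) (Option (Fin n))) (hr : r ∈ L.classRules t e)
      (x : TaggedSymbol α) (hx : Symbol.terminal x ∈ r.output) : x ∈ t.terminals := by
    rcases hr with ⟨A, -, rfl⟩ | ⟨A, c, i, w, hc, -, -, -, rfl⟩ |
      ⟨A, a, b, i, j, w, w', hab, -, -, -, -, -, rfl⟩
    · simp at hx
    · obtain rfl : x = (.plain, c) := by simpa using hx
      exact ⟨c, by simp [Tagging.symbol, hc]⟩
    · obtain rfl | rfl : x = (.call, a) ∨ x = (.ret, b) := by simpa using hx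
      · exact ⟨a, by simp [Tagging.symbol, t.kind_left a b hab]⟩
      · exact ⟨b, by simp [Tagging.symbol, t.kind_right a b hab]⟩
  exact fun r hr ↦ h r (mem_rules_classGrammar.1 hr)

/-- A rule is justified by some representatives of its classes. The generated words have the same
contexts as those representatives, and equality of contexts is a congruence, so they may be
substituted one at a time. -/
theorem inClass_of_gen {A : (L.classGrammar t e).NT} {w : List α}
    (h : (L.classGrammar t e).Gen A w) : t.WellMatched w ∧ L.InClass e A w := by
  induction h with
  | eps A hr =>
    rcases mem_rules_classGrammar.1 hr with ⟨A', hA, h⟩ | ⟨A', c, i, w, -, -, -, -, h⟩ |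
      ⟨A', a, b, i, j, w, w', -, -, -, -, -, -, h⟩ <;> cases h
    exact ⟨.nil, hA⟩
  | plain A B c s hr _ ih =>
    rcases mem_rules_classGrammar.1 hr with ⟨A', hA, h⟩ | ⟨A', c', i, w, hc, -, hi, hA, h⟩ |
      ⟨A', a, b, i, j, w, w', -, -, -, -, -, -, h⟩ <;> cases h
    refine ⟨.plain _ _ hc ih.1, hA.congr ?_⟩
    simpa using L.contexts_append (hi.symm.trans ih.2) [c] []
  | matched A B C a b s₁ s₂ hr _ _ ih₁ ih₂ =>
    rcases mem_rules_classGrammar.1 hr with ⟨A', hA, h⟩ | ⟨A', c', i, w, hc, -, hi, hA, h⟩ |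
      ⟨A', a', b', i, j, w, w', hab, -, -, hi, hj, hA, h⟩ <;> cases h
    refine ⟨.matched _ _ _ _ hab ih₁.1 ih₂.1, hA.congr ?_⟩
    have h₁ := L.contexts_append (hi.symm.trans ih₁.2) [a] (b :: w')
    have h₂ := L.contexts_append (hj.symm.trans ih₂.2) (a :: (s₁ ++ [b])) []
    simp only [List.append_nil, List.append_assoc, List.cons_append, List.nil_append] at h₁ h₂
    exact h₁.trans h₂

/-- Along the decomposition of a well-matched word, its own subwords serve as the representatives
that justify each rule. -/
theorem gen_of_inClass (he : ∀ w, t.WellMatched w → ∃ i, e i = L.contexts w) {w : List α}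
    (hw : t.WellMatched w) {A : (L.classGrammar t e).NT} (hA : L.InClass e A w) :
    (L.classGrammar t e).Gen A w := by
  induction hw generalizing A with
  | nil => exact .eps _ (mem_rules_classGrammar.2 (.inl ⟨A, hA, rfl⟩))
  | plain c s hc hs ih =>
    obtain ⟨i, hi⟩ := he s hs
    exact .plain _ (some i : Option (Fin n)) _ _ (mem_rules_classGrammar.2
      (.inr (.inl ⟨A, c, i, s, hc, hs, hi, hA, rfl⟩)))
      (ih (A := (some i : Option (Fin n))) hi)
  | matched a b s₁ s₂ hab h₁ h₂ ih₁ ih₂ =>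
    obtain ⟨i, hi⟩ := he s₁ h₁
    obtain ⟨j, hj⟩ := he s₂ h₂
    exact .matched _ (some i : Option (Fin n)) (some j : Option (Fin n)) _ _ _ _
      (mem_rules_classGrammar.2
        (.inr (.inr ⟨A, a, b, i, j, s₁, s₂, hab, h₁, h₂, hi, hj, hA, rfl⟩)))
      (ih₁ (A := (some i : Option (Fin n))) hi) (ih₂ (A := (some j : Option (Fin n))) hj)

end classGrammar

/-- A language of well-matched words with finitely many context classes of well-matched words is a
visibly pushdown language. -/
theorem isVPL_of_finite_contexts [Finite α] {L : Language α} {t : Tagging α}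
    (hL : ∀ s ∈ L, t.WellMatched s) (hfin : (L.contexts '' {w | t.WellMatched w}).Finite) :
    IsVPL t.terminals (t.taggedLanguage L) := by
  have := hfin.to_subtype
  obtain ⟨n, ⟨e⟩⟩ := Finite.exists_equiv_fin ↥(L.contexts '' {w | t.WellMatched w})
  let e' (i : Fin n) : Set (List α × List α) := (e.symm i).1
  have he (w : List α) (hw : t.WellMatched w) : ∃ i, e' i = L.contexts w :=
    ⟨e ⟨_, w, hw, rfl⟩, by simp [e']⟩
  refine ⟨L.classGrammar t e', isVPG_classGrammar, terminalsIn_classGrammar, ?_⟩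
  ext W
  constructor
  · intro hW
    obtain ⟨s, rfl⟩ :=
      ContextFreeGrammar.exists_map_symbol_of_mem_language terminalsIn_classGrammar hW
    have h := inClass_of_gen ((ContextFreeGrammar.map_symbol_mem_language_iff isVPG_classGrammar
      terminalsIn_classGrammar).1 hW)
    exact ⟨s, h.2, rfl⟩
  · rintro ⟨s, hs, rfl⟩
    exact (ContextFreeGrammar.map_symbol_mem_language_iff isVPG_classGrammar
      terminalsIn_classGrammar).2 (gen_of_inClass he (hL s hs) hs)

end Language

/-- If the language `L` is a visibly pushdown language under the oracle tagging `tO`, then it is a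
visibly pushdown language under every tagging `t` that is compatible with `L`. -/
theorem theorem2 {α : Type*} [Finite α] (L : Language α) (tO : Tagging α)
    (hO : IsVPL tO.terminals (tO.taggedLanguage L))
    (t : Tagging α) (ht : t.Compatible L) :
    IsVPL t.terminals (t.taggedLanguage L) := by
  obtain ⟨G, hG, hT, hLG⟩ := hO
  have hL (s : List α) : s ∈ L ↔ G.Gen G.initial s := by
    rw [← ContextFreeGrammar.map_symbol_mem_language_iff hG hT, hLG]
    have hinj : Function.Injective tO.symbol := fun a b h ↦ congrArg Prod.snd h
    exact (hinj.list_map.mem_set_image (s := L)).symm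
  exact Language.isVPL_of_finite_contexts (fun s hs ↦ (ht s hs).1 s rfl)
    (ContextFreeGrammar.finite_contexts hT hL ht)
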